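/- Let $\mathbb F$ be an algebraically closed field (not containing $\infty$), let $N\ge 1$ and $m$ be integers, and let nodes $\sigma_0,\dots,\sigma_{N-1}\in\mathbb F$, poles $\xi_1,\dots,\xi_N\in(\mathbb F\setminus\{0\})\cup\{\infty\}$, scaling parameters $\beta_0,\dots,\beta_N\in\mathbb F\setminus\{0\}$ and matrices $D_0,\dots,D_N\in\mathbb F^{m\times m}$ be given. Put $g_i(\lambda)=\beta_i(1-\lambda/\xi_i)$ for $1\le i\le N$ (with $\lambda/\infty=0$) and $h_j(\lambda)=\lambda-\sigma_j$ for $0\le j\le N-1$, and let $$b_i(\lambda)=\frac1{\beta_0}\prod_{k=1}^{i}\frac{h_{k-1}(\lambda)}{g_k(\lambda)}\quad(0\le i\le N),\qquad Q_N(\lambda)=\sum_{i=0}^N b_i(\lambda)D_i,\qquad R_N(\lambda)=\sum_{j=1}^{N-1}\Big(\prod_{k=j+1}^{N}\frac{g_k(\lambda)}{h_{k-1}(\lambda)}\Big)D_j+D_N .$$ Let $L_N(\lambda)=\begin{bmatrix}M_N(\lambda)\\K_N(\lambda)\end{bmatrix}$, where $$M_N=\Big[\tfrac{g_N}{\beta_N}D_0\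 \ \tfrac{g_N}{\beta_N}D_1\ \cdots\ \tfrac{g_N}{\beta_N}D_{N-2}\ \ \tfrac{g_N}{\beta_N}D_{N-1}+\tfrac{h_{N-1}}{\beta_N}D_N\Big],\qquad K_N=\begin{bmatrix}-h_0&g_1\\&-h_1&g_2\\&&\ddots&\ddots\\&&&-h_{N-2}&g_{N-1}\end{bmatrix}\otimes I_m ,$$ and partition $L_N=\begin{bmatrix}D&-C\\B&A_N\end{bmatrix}$, where $\begin{bmatrix}D\\B\end{bmatrix}$ is the first block column of $L_N$ and $D$ is $m\times m$. Thus $A_N$, the state matrix, is $K_N$ without its first block column; it is empty if $N=1$. Definitions. A polynomial matrix $P=\begin{bmatrix}D&-C\\B&A\end{bmatrix}$ with $A$ of size $n\times n$ is a polynomial system matrix with state matrix $A$ if $\det A\not\equiv0$; its transfer function matrix is $\widehat G=D+CA^{-1}B$. It is minimal at $\lambda_0\in\mathbb F$ if $\operatorname{rank}\begin{bmatrix}A(\lambda_0)\\C(\lambda_0)\end{bmatrix}=\operatorname{rank}\begin{bmatrix}A(\lambda_0)&B(\lambda_0)\end{bmatrix}=n$ (always true if $n=0$). A square rational matrix is regular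 at $\lambda_0$ if it is defined at $\lambda_0$ and its value there is nonsingular. If the entries of $P$ have degree at most $1$ and $\widehat G$ is $q\times r$, then $P$ is a linearization at $\lambda_0$ of a rational $p\times s$ matrix $G$, with state matrix $A$, if $P$ is minimal at $\lambda_0$ and there are integers $s_1,s_2\ge0$ with $s_1-s_2=q-p=r-s$ and rational matrices $R_1,R_2$ regular at $\lambda_0$ such that $R_1\operatorname{diag}(G,I_{s_1})R_2=\operatorname{diag}(\widehat G,I_{s_2})$. Minimal, or a linearization, in a set means: at each of its points. Theorem. (a) $L_N$ is a polynomial system matrix with state matrix $A_N$, and its transfer function matrix is $\beta_0(1-\lambda/\xi_N)\,Q_N(\lambda)$. Assume from here on that $\xi_i\ne\sigma_j$ for all $1\le i\le N$ and $0\le j\le N-1$, and let $\mathcal P_{N-1}$ be the set of finite poles among $\xi_1,\dots,\xi_{N-1}$. (b) $R_N$ is defined at every $\xi_k\in\mathcal P_{N-1}$, and $L_N$, with state matrix $A_N$, is minimal in $\mathbb F$ if and only if $R_N(\xi_k)$ is nonsingular for every $\xi_k\in\mathcal P_{N-1}$. (c) If $R_N(\xi_k)$ is nonsingular for every $\xi_k\in\mathcal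 P_{N-1}$, then $L_N$ is minimal in $\mathbb F$, and $L_N$ is a linearization of $Q_N$ with state matrix $A_N$ in $\mathbb F$ if $\xi_N=\infty$, and in $\mathbb F\setminus\{\xi_N\}$ if $\xi_N$ is finite. -/

import Mathlib

namespace NLEIGS

open Polynomial
open scoped OnePoint Kronecker

noncomputable section

variable {F : Type*} [Field F]

/-! ### Rational matrices at a point -/

/-- A rational matrix is defined at `x` if no entry, in lowest terms, has a denominator
vanishing at `x`. -/
def IsDefinedAt {ι κ : Type*} (R : Matrix ι κ (RatFunc F)) (x : F) : Prop :=
  ∀ i j, ((R i j).denom).eval x ≠ 0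

/-- The value `R(x)` of a rational matrix (meaningful where `R` is defined). -/
def evalRat {ι κ : Type*} (R : Matrix ι κ (RatFunc F)) (x : F) : Matrix ι κ F :=
  R.map (RatFunc.eval (RingHom.id F) x)

/-- A square rational matrix is regular at `x` if it is defined at `x` and `det R(x) ≠ 0`. -/
def IsRegularAt {ι : Type*} [Fintype ι] [DecidableEq ι] (R : Matrix ι ι (RatFunc F)) (x : F) :
    Prop :=
  IsDefinedAt R x ∧ (evalRat R x).det ≠ 0

/-- The value of a polynomial matrix at `x`. -/
def evalPoly {ι κ : Type*} (P : Matrix ι κ F[X]) (x : F) : Matrix ι κ F :=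
  P.map (Polynomial.eval x)

/-- A polynomial matrix, seen as a rational matrix. -/
def toRat {ι κ : Type*} (P : Matrix ι κ F[X]) : Matrix ι κ (RatFunc F) :=
  P.map (algebraMap F[X] (RatFunc F))

/-- A constant matrix, seen as a rational matrix. -/
def constRat {ι κ : Type*} (D : Matrix ι κ F) : Matrix ι κ (RatFunc F) :=
  D.map RatFunc.C

/-- The block diagonal matrix `diag(G, I_s)`. -/
def diagId {p q : Type*} (G : Matrix p q (RatFunc F)) (s : ℕ) :
    Matrix (p ⊕ Fin s) (q ⊕ Fin s) (RatFunc F) :=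
  Matrix.fromBlocks G 0 0 1

/-! ### Polynomial system matrices

A polynomial matrix partitioned as `P = [D, -C; B, A]` with a square block `A` is encoded by
its row index type `q ⊕ n` and its column index type `r ⊕ n`. The state matrix is the lower
right block. -/

section SystemMatrix

variable {n p q r s : Type*}

/-- The state matrix `A`. -/
def stateA (P : Matrix (q ⊕ n) (r ⊕ n) F[X]) : Matrix n n F[X] := P.toBlocks₂₂

/-- The block `B`. -/
def blockB (P : Matrix (q ⊕ n) (r ⊕ n) F[X]) : Matrix n r F[X] := P.toBlocks₂₁

/-- The block `C`; the upper right block of `P` is `-C`. -/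
def blockC (P : Matrix (q ⊕ n) (r ⊕ n) F[X]) : Matrix q n F[X] := -P.toBlocks₁₂

/-- The block `D`. -/
def blockD (P : Matrix (q ⊕ n) (r ⊕ n) F[X]) : Matrix q r F[X] := P.toBlocks₁₁

variable [Fintype n] [DecidableEq n]

/-- `P` is a polynomial system matrix (for its partition): the state matrix is nonsingular as a
polynomial matrix. -/
def IsSystemMatrix (P : Matrix (q ⊕ n) (r ⊕ n) F[X]) : Prop := (stateA P).det ≠ 0

/-- The transfer function matrix `D + C A⁻¹ B`. -/
def transfer (P : Matrix (q ⊕ n) (r ⊕ n) F[X]) : Matrix q r (RatFunc F) :=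
  toRat (blockD P) + toRat (blockC P) * (toRat (stateA P))⁻¹ * toRat (blockB P)

/-- `P` is minimal at `x`: both `[A(x); C(x)]` and `[A(x), B(x)]` have rank equal to the size of
`A`. For an empty state matrix this holds automatically. -/
def IsMinimalAt [Fintype r] (P : Matrix (q ⊕ n) (r ⊕ n) F[X]) (x : F) : Prop :=
  (Matrix.fromRows (evalPoly (stateA P) x) (evalPoly (blockC P) x)).rank = Fintype.card n ∧
  (Matrix.fromCols (evalPoly (stateA P) x) (evalPoly (blockB P) x)).rank = Fintype.card n

/-- Minimality in a set of points. -/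
def IsMinimalOn [Fintype r] (P : Matrix (q ⊕ n) (r ⊕ n) F[X]) (S : Set F) : Prop :=
  ∀ x ∈ S, IsMinimalAt P x

/-- `P`, with its state matrix, is a linearization at `x` of the rational matrix `G` of size
`p × s`: `P` is a linear polynomial system matrix, minimal at `x`, and for its transfer function
matrix `H` of size `q × r` one has `R₁ diag(G, I_{s₁}) R₂ = diag(H, I_{s₂})` with `R₁`, `R₂`
rational and regular at `x`. The bijections `e₁`, `e₂` exist exactly if
`s₁ - s₂ = |q| - |p| = |r| - |s|`; they identify the index sets of the two sides. -/
def IsLinearizationAt [Fintype r] [Fintype p] [Fintype s] [DecidableEq p] [DecidableEq s]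
    (P : Matrix (q ⊕ n) (r ⊕ n) F[X]) (G : Matrix p s (RatFunc F)) (x : F) : Prop :=
  IsSystemMatrix P ∧ (∀ i j, (P i j).natDegree ≤ 1) ∧ IsMinimalAt P x ∧
  ∃ (s₁ s₂ : ℕ) (e₁ : p ⊕ Fin s₁ ≃ q ⊕ Fin s₂) (e₂ : s ⊕ Fin s₁ ≃ r ⊕ Fin s₂)
    (R₁ : Matrix (p ⊕ Fin s₁) (p ⊕ Fin s₁) (RatFunc F))
    (R₂ : Matrix (s ⊕ Fin s₁) (s ⊕ Fin s₁) (RatFunc F)),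
    IsRegularAt R₁ x ∧ IsRegularAt R₂ x ∧
    R₁ * diagId G s₁ * R₂ = (diagId (transfer P) s₂).submatrix e₁ e₂

/-- Linearization in a set of points. -/
def IsLinearizationOn [Fintype r] [Fintype p] [Fintype s] [DecidableEq p] [DecidableEq s]
    (P : Matrix (q ⊕ n) (r ⊕ n) F[X]) (G : Matrix p s (RatFunc F)) (S : Set F) : Prop :=
  ∀ x ∈ S, IsLinearizationAt P G x

end SystemMatrix

/-! ### NLEIGS data

The nodes `σ 0, …, σ (N-1)`, the poles `ξ 1, …, ξ N`, the scaling parameters `β 0, …, β N` and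
the matrices `D 0, …, D N` are given by functions on `ℕ`; no other values are used. -/

/-- `1/ξ`, with `1/∞ = 0`. -/
def invPole : OnePoint F → F
  | ∞ => 0
  | OnePoint.some a => a⁻¹

/-- The polynomial `1 - λ/ξ`. -/
def poleFactor (ξ : OnePoint F) : F[X] := 1 - C (invPole ξ) * X

/-- `g_i(λ) = β_i (1 - λ/ξ_i)`. -/
def g (ξ : ℕ → OnePoint F) (β : ℕ → F) (i : ℕ) : F[X] := C (β i) * poleFactor (ξ i)

/-- `h_j(λ) = λ - σ_j`. -/
def h (σ : ℕ → F) (j : ℕ) : F[X] := X - C (σ j)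

/-- `b_i(λ) = (1/β_0) ∏_{k=1}^{i} (λ - σ_{k-1}) / (β_k (1 - λ/ξ_k))`. -/
def b (σ : ℕ → F) (ξ : ℕ → OnePoint F) (β : ℕ → F) (i : ℕ) : RatFunc F :=
  (RatFunc.C (β 0))⁻¹ * ∏ k ∈ Finset.Icc 1 i,
    algebraMap F[X] (RatFunc F) (h σ (k - 1)) / algebraMap F[X] (RatFunc F) (g ξ β k)

variable {m : ℕ}

/-- `Q_N(λ) = b_0(λ) D_0 + ⋯ + b_N(λ) D_N`. -/
def Q (N : ℕ) (σ : ℕ → F) (ξ : ℕ → OnePoint F) (β : ℕ → F)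
    (D : ℕ → Matrix (Fin m) (Fin m) F) : Matrix (Fin m) (Fin m) (RatFunc F) :=
  ∑ i ∈ Finset.range (N + 1), b σ ξ β i • constRat (D i)

/-- `R_N(λ) = ∑_{j=1}^{N-1} (∏_{k=j+1}^{N} g_k(λ) / h_{k-1}(λ)) D_j + D_N`. -/
def R (N : ℕ) (σ : ℕ → F) (ξ : ℕ → OnePoint F) (β : ℕ → F)
    (D : ℕ → Matrix (Fin m) (Fin m) F) : Matrix (Fin m) (Fin m) (RatFunc F) :=
  (∑ j ∈ Finset.Icc 1 (N - 1),
    (∏ k ∈ Finset.Icc (j + 1) N,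
      algebraMap F[X] (RatFunc F) (g ξ β k) / algebraMap F[X] (RatFunc F) (h σ (k - 1))) •
        constRat (D j)) + constRat (D N)

/-- The block row `M_N(λ)`: its block column `j`, for `0 ≤ j ≤ N - 1`, is `(g_N / β_N) D_j`, with
the additional summand `(h_{N-1} / β_N) D_N` in the last one. -/
def M (N : ℕ) (σ : ℕ → F) (ξ : ℕ → OnePoint F) (β : ℕ → F)
    (D : ℕ → Matrix (Fin m) (Fin m) F) : Matrix (Fin m) (Fin N × Fin m) F[X] :=
  Matrix.of fun a jc =>
    C (β N)⁻¹ * g ξ β N * C (D jc.1 a jc.2) +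
      if (jc.1 : ℕ) + 1 = N then C (β N)⁻¹ * h σ (N - 1) * C (D N a jc.2) else 0

/-- The `(N-1) × N` bidiagonal matrix whose row `i`, for `0 ≤ i ≤ N - 2`, has the entry `-h_i` in
column `i` and the entry `g_{i+1}` in column `i + 1`. -/
def bidiag (N : ℕ) (σ : ℕ → F) (ξ : ℕ → OnePoint F) (β : ℕ → F) :
    Matrix (Fin (N - 1)) (Fin N) F[X] :=
  Matrix.of fun i j =>
    if (j : ℕ) = i then -h σ i else if (j : ℕ) = i + 1 then g ξ β (i + 1) else 0

/-- `K_N(λ)`, the Kronecker product of the bidiagonal matrix with `I_m`. -/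
def K (N m : ℕ) (σ : ℕ → F) (ξ : ℕ → OnePoint F) (β : ℕ → F) :
    Matrix (Fin (N - 1) × Fin m) (Fin N × Fin m) F[X] :=
  bidiag N σ ξ β ⊗ₖ (1 : Matrix (Fin m) (Fin m) F[X])

/-- The pencil `L_N(λ) = [M_N(λ); K_N(λ)]`. -/
def L (N : ℕ) (σ : ℕ → F) (ξ : ℕ → OnePoint F) (β : ℕ → F)
    (D : ℕ → Matrix (Fin m) (Fin m) F) :
    Matrix (Fin m ⊕ (Fin (N - 1) × Fin m)) (Fin N × Fin m) F[X] :=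
  Matrix.fromRows (M N σ ξ β D) (K N m σ ξ β)

/-- The partition of the columns of `L_N` into the first block column and the other ones. -/
def colSplit {N : ℕ} (hN : 1 ≤ N) (m : ℕ) :
    Fin m ⊕ (Fin (N - 1) × Fin m) → Fin N × Fin m
  | Sum.inl c => (⟨0, hN⟩, c)
  | Sum.inr (j, c) => (⟨(j : ℕ) + 1, by omega⟩, c)

/-- `L_N(λ)` partitioned as `[D_N, -C_N; B_N, A_N]`, where the left blocks form the first block
column. Thus the state matrix `A_N` is `K_N` without its first block column. -/
def LPart {N : ℕ} (hN : 1 ≤ N) (σ : ℕ → F) (ξ : ℕ → OnePoint F) (β : ℕ → F)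
    (D : ℕ → Matrix (Fin m) (Fin m) F) :
    Matrix (Fin m ⊕ (Fin (N - 1) × Fin m)) (Fin m ⊕ (Fin (N - 1) × Fin m)) F[X] :=
  (L N σ ξ β D).submatrix id (colSplit hN m)

end

end NLEIGS

/-! The pencil `L_N` acts on block vectors `V_0, …, V_{N-1}`. Its lower block row `K_N` expresses the
two-term recurrence `g_{i+1} V_{i+1} = h_i V_i`, and its upper block row `M_N` the combination
`β_N⁻¹ (g_N ∑_{j < N} D_j V_j + h_{N-1} D_N V_{N-1})`. These two formulas, `lower_mulVec` and
`upper_mulVec`, are stated for the image of the pencil under any ring homomorphism out of `F[X]`, so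
that they serve for rational matrices as well as for values at a point.

*Transfer function.* The functions `b_i` satisfy the recurrence, so `K_N` annihilates the block
column of the `b_i I`, while `M_N` sends it to `(1 - λ/ξ_N) Q_N`. As the state matrix is block
triangular with the nonsingular diagonal blocks `g_i I`, elimination of the lower blocks gives
`b_0 = 1/β_0` times the transfer function matrix (`transfer_LPart`).

*Minimality.* If nodes and poles are disjoint, then at every point either all `g_i` or all `h_j` are
nonzero, so one of the two triangular square parts of `K_N` is nonsingular and `[A_N, B_N]` has full
rank (`rank_fromCols_stateA_blockB`). The matrix `[A_N; C_N]` can lose rank only where `A_N` is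
singular, that is, at a finite pole `ξ_k` with `k < N`. There all `h_j` are nonzero, so the
recurrence, read downwards, writes each `V_j` as `∏_{i=j+1}^{N-1} g_i / h_{i-1}` times the last
block. The product for `j = 0` vanishes, so that `V_0 = 0` is automatic, and the upper block row
becomes `h_{N-1} β_N⁻¹ R_N` applied to the last block. Hence the common kernel of `A_N` and `C_N` is
that of `R_N(ξ_k)` (`rank_fromRows_iff_of_pole`, `isMinimalAt_LPart_iff`).

*Linearization.* Away from `ξ_N` the scalar `β_0 (1 - λ/ξ_N)` is regular, so the transfer function
matrix and `Q_N` are equivalent there without enlargement by identity blocks. -/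

namespace NLEIGS

open Polynomial
open scoped OnePoint Kronecker

/-! ### Values of rational functions -/

section Values

variable {F : Type*} [Field F] {x : F}

/-- The rational function `f`, in lowest terms, is defined at `x` and has the value `v` there.
Unlike the total function `RatFunc.eval`, this relation is compatible with all sums and
products. -/
def HasValueAt (f : RatFunc F) (x v : F) : Prop :=
  f.denom.eval x ≠ 0 ∧ f.eval (RingHom.id F) x = v

theorem HasValueAt.add {f₁ f₂ : RatFunc F} {v₁ v₂ : F} (h₁ : HasValueAt f₁ x v₁)
    (h₂ : HasValueAt f₂ x v₂) : HasValueAt (f₁ + f₂) x (v₁ + v₂) := by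
  refine ⟨fun h0 => ?_, ?_⟩
  · have := eval_eq_zero_of_dvd_of_eval_eq_zero (RatFunc.denom_add_dvd f₁ f₂) h0
    rw [eval_mul] at this
    exact mul_ne_zero h₁.1 h₂.1 this
  · rw [RatFunc.eval_add (RingHom.id F) (a := x) h₁.1 h₂.1, h₁.2, h₂.2]

theorem HasValueAt.mul {f₁ f₂ : RatFunc F} {v₁ v₂ : F} (h₁ : HasValueAt f₁ x v₁)
    (h₂ : HasValueAt f₂ x v₂) : HasValueAt (f₁ * f₂) x (v₁ * v₂) := by
  refine ⟨fun h0 => ?_, ?_⟩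
  · have := eval_eq_zero_of_dvd_of_eval_eq_zero (RatFunc.denom_mul_dvd f₁ f₂) h0
    rw [eval_mul] at this
    exact mul_ne_zero h₁.1 h₂.1 this
  · rw [RatFunc.eval_mul (RingHom.id F) (a := x) h₁.1 h₂.1, h₁.2, h₂.2]

theorem hasValueAt_algebraMap (p : F[X]) (x : F) :
    HasValueAt (algebraMap F[X] (RatFunc F) p) x (p.eval x) := by
  refine ⟨by simp, ?_⟩
  simp [RatFunc.eval]

theorem hasValueAt_C (a x : F) : HasValueAt (RatFunc.C a) x a := by
  simpa using hasValueAt_algebraMap (C a) x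

theorem hasValueAt_div (p : F[X]) {q : F[X]} (hq : q.eval x ≠ 0) :
    HasValueAt (algebraMap F[X] (RatFunc F) p / algebraMap F[X] (RatFunc F) q) x
      (p.eval x / q.eval x) := by
  set f := algebraMap F[X] (RatFunc F) p / algebraMap F[X] (RatFunc F) q
  have hd : f.denom.eval x ≠ 0 := fun h0 =>
    hq (eval_eq_zero_of_dvd_of_eval_eq_zero (RatFunc.denom_div_dvd p q) h0)
  have hq0 : algebraMap F[X] (RatFunc F) q ≠ 0 := by
    intro h0
    rw [map_eq_zero_iff _ (RatFunc.algebraMap_injective F)] at h0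
    simp [h0] at hq
  have hmul : f * algebraMap F[X] (RatFunc F) q = algebraMap F[X] (RatFunc F) p :=
    div_mul_cancel₀ _ hq0
  have hv := (HasValueAt.mul ⟨hd, rfl⟩ (hasValueAt_algebraMap q x)).2
  rw [hmul, (hasValueAt_algebraMap p x).2] at hv
  exact ⟨hd, (eq_div_iff hq).2 hv.symm⟩

theorem HasValueAt.sum {ι : Type*} (s : Finset ι) {f : ι → RatFunc F} {v : ι → F}
    (hf : ∀ i ∈ s, HasValueAt (f i) x (v i)) : HasValueAt (∑ i ∈ s, f i) x (∑ i ∈ s, v i) := by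
  classical
  induction s using Finset.induction_on with
  | empty => simpa using hasValueAt_C 0 x
  | insert a s ha ih =>
    rw [Finset.sum_insert ha, Finset.sum_insert ha]
    exact (hf a (by simp)).add (ih fun i hi => hf i (by simp [hi]))

theorem HasValueAt.prod {ι : Type*} (s : Finset ι) {f : ι → RatFunc F} {v : ι → F}
    (hf : ∀ i ∈ s, HasValueAt (f i) x (v i)) : HasValueAt (∏ i ∈ s, f i) x (∏ i ∈ s, v i) := by
  classical
  induction s using Finset.induction_on with
  | empty => simpa using hasValueAt_C 1 x
  | insert a s ha ih =>
    rw [Finset.prod_insert ha, Finset.prod_insert ha]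
    exact (hf a (by simp)).mul (ih fun i hi => hf i (by simp [hi]))

end Values

/-! ### Full rank -/

section Rank

theorem rank_eq_card_width_iff {F ι κ : Type*} [Field F] [Finite ι] [Fintype κ]
    (A : Matrix ι κ F) : A.rank = Fintype.card κ ↔ ∀ v, A.mulVec v = 0 → v = 0 := by
  have h := A.mulVecLin.finrank_range_add_finrank_ker
  rw [Module.finrank_fintype_fun_eq_card] at h
  have h' : A.rank + Module.finrank F (LinearMap.ker A.mulVecLin) = Fintype.card κ := h
  have hk : (∀ v, A.mulVec v = 0 → v = 0) ↔ LinearMap.ker A.mulVecLin = ⊥ := by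
    rw [LinearMap.ker_eq_bot']
    rfl
  rw [hk, ← Submodule.finrank_eq_zero]
  omega

/-- A choice of columns that forms a nonsingular square matrix shows that the rows are
independent. -/
theorem rank_eq_card_of_submatrix_det_ne_zero {F κ n : Type*} [Field F] [Fintype n]
    [DecidableEq n] [Fintype κ] (A : Matrix n κ F) (c : n → κ)
    (hA : (A.submatrix id c).det ≠ 0) : A.rank = Fintype.card n := by
  refine le_antisymm A.rank_le_card_height ?_
  rw [← Matrix.rank_of_det_ne_zero hA]
  exact A.rank_submatrix_le id c

end Rank

/-! ### The blocks of the pencil -/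

section Blocks

variable {F : Type*} [Field F] {m n : ℕ} (σ : ℕ → F) (ξ : ℕ → OnePoint F) (β : ℕ → F)
  (D : ℕ → Matrix (Fin m) (Fin m) F)

/-- The case `ξ i = 0` has to be excluded: the junk value `0⁻¹ = 0` would turn `1 - λ/ξ` into
`1`. -/
theorem eval_g_eq_zero_iff {ξ : ℕ → OnePoint F} {β : ℕ → F} {i : ℕ}
    (hξ : ξ i ≠ ((0 : F) : OnePoint F)) (hβ : β i ≠ 0) (x : F) :
    (g ξ β i).eval x = 0 ↔ ξ i = (x : OnePoint F) := by
  have key : ∀ p : OnePoint F, p ≠ ((0 : F) : OnePoint F) →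
      (1 - invPole p * x = 0 ↔ p = (x : OnePoint F)) := by
    intro p hp
    induction p using OnePoint.rec with
    | infty => simp [invPole]
    | coe a =>
      have ha : a ≠ 0 := fun h => hp (by rw [h])
      change 1 - a⁻¹ * x = 0 ↔ _
      rw [OnePoint.coe_eq_coe, sub_eq_zero, eq_inv_mul_iff_mul_eq₀ ha, mul_one]
  simp [g, poleFactor, hβ, key _ hξ]

theorem g_ne_zero {ξ : ℕ → OnePoint F} {β : ℕ → F} {i : ℕ} (hβ : β i ≠ 0) : g ξ β i ≠ 0 := by
  intro h0
  have := congrArg (Polynomial.eval 0) h0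
  simp [g, poleFactor, hβ] at this

/-- The scalar state matrix: the bidiagonal matrix without its first column. -/
noncomputable def scalarState (n : ℕ) (σ : ℕ → F) (ξ : ℕ → OnePoint F) (β : ℕ → F) :
    Matrix (Fin n) (Fin n) F[X] :=
  (bidiag (n + 1) σ ξ β).submatrix id Fin.succ

theorem stateA_LPart (hN : 1 ≤ n + 1) :
    stateA (LPart hN σ ξ β D) =
      scalarState n σ ξ β ⊗ₖ (1 : Matrix (Fin m) (Fin m) F[X]) := by
  ext ⟨i, c⟩ ⟨j, d⟩ : 2
  rfl

theorem det_scalarState : (scalarState n σ ξ β).det = ∏ i : Fin n, g ξ β (i + 1) := by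
  rw [Matrix.det_of_isLowerTriangular]
  · refine Finset.prod_congr rfl fun i _ => ?_
    simp [scalarState, bidiag]
  · intro i j hij
    have hij' : (i : ℕ) < j := hij
    simp only [scalarState, bidiag, Matrix.submatrix_apply, Matrix.of_apply, id_eq, Fin.val_succ]
    rw [if_neg (by omega), if_neg (by omega)]

/-- The state matrix is block lower bidiagonal with the diagonal blocks `g_i I`, `1 ≤ i ≤ N - 1`. -/
theorem det_stateA (hN : 1 ≤ n + 1) :
    (stateA (LPart hN σ ξ β D)).det = (∏ i : Fin n, g ξ β (i + 1)) ^ m := by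
  rw [stateA_LPart]
  erw [Matrix.det_kronecker]
  simp [det_scalarState]

/-- The bidiagonal matrix without its last column is upper triangular. -/
theorem det_bidiag_castSucc :
    ((bidiag (n + 1) σ ξ β).submatrix id Fin.castSucc : Matrix (Fin n) (Fin n) F[X]).det =
      ∏ i : Fin n, -h σ i := by
  rw [Matrix.det_of_isUpperTriangular]
  · refine Finset.prod_congr rfl fun i _ => ?_
    simp [bidiag]
  · intro i j hij
    have hij' : (j : ℕ) < i := hij
    simp only [bidiag, Matrix.submatrix_apply, Matrix.of_apply, id_eq, Fin.val_castSucc]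
    rw [if_neg (by omega), if_neg (by omega)]

/-- The lower block row of the pencil, applied to a block vector `V 0, …, V n`. -/
theorem lower_mulVec {S : Type*} [CommRing S] (φ : F[X] →+* S) (hN : 1 ≤ n + 1)
    (V : ℕ → Fin m → S) (i : Fin n) (c : Fin m) :
    ((blockB (LPart hN σ ξ β D)).map φ).mulVec (V 0) (i, c) +
      ((stateA (LPart hN σ ξ β D)).map φ).mulVec (fun p => V (p.1 + 1) p.2) (i, c) =
    φ (g ξ β (i + 1)) * V (i + 1) c - φ (h σ i) * V i c := by
  have key : ∑ j : Fin (n + 1), ∑ d : Fin m,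
      φ (K (n + 1) m σ ξ β (i, c) (j, d)) * V j d =
      φ (g ξ β (i + 1)) * V (i + 1) c - φ (h σ i) * V i c := by
    have h1 : ∀ j : Fin (n + 1), ∑ d : Fin m, φ (K (n + 1) m σ ξ β (i, c) (j, d)) * V j d =
        (if (j : ℕ) = i then -φ (h σ i) * V i c else 0) +
          (if (j : ℕ) = i + 1 then φ (g ξ β (i + 1)) * V (i + 1) c else 0) := by
      intro j
      rw [Finset.sum_eq_single c]
      · simp only [K, bidiag, Matrix.kroneckerMap_apply, Matrix.of_apply, Matrix.one_apply_eq,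
          mul_one]
        by_cases h1 : (j : ℕ) = i
        · simp [h1]
        · by_cases h2 : (j : ℕ) = i + 1 <;> simp [h1, h2]
      · intro d _ hd
        simp [K, Matrix.kroneckerMap_apply, Matrix.one_apply_ne hd.symm]
      · simp
    rw [Finset.sum_congr rfl fun j _ => h1 j, Finset.sum_add_distrib,
      Fin.sum_univ_eq_sum_range (fun j => if j = (i : ℕ) then -φ (h σ i) * V i c else 0),
      Fin.sum_univ_eq_sum_range
        (fun j => if j = (i : ℕ) + 1 then φ (g ξ β (i + 1)) * V (i + 1) c else 0),
      Finset.sum_ite_eq', Finset.sum_ite_eq', if_pos (Finset.mem_range.2 (by omega)),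
      if_pos (Finset.mem_range.2 (by omega))]
    ring
  rw [← key, Fin.sum_univ_succ]
  congr 1
  exact Fintype.sum_prod_type _

/-- The upper block row of the pencil, applied to a block vector `V 0, …, V n`. -/
theorem upper_mulVec {S : Type*} [CommRing S] (φ : F[X] →+* S) (hN : 1 ≤ n + 1)
    (V : ℕ → Fin m → S) (a : Fin m) :
    ((blockD (LPart hN σ ξ β D)).map φ).mulVec (V 0) a -
      ((blockC (LPart hN σ ξ β D)).map φ).mulVec (fun p => V (p.1 + 1) p.2) a =
    φ (C (β (n + 1))⁻¹) * (φ (g ξ β (n + 1)) *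
        (∑ j ∈ Finset.range (n + 1), ∑ d, φ (C (D j a d)) * V j d) +
      φ (h σ n) * ∑ d, φ (C (D (n + 1) a d)) * V n d) := by
  have key : ∑ j : Fin (n + 1), ∑ d : Fin m, φ (M (n + 1) σ ξ β D a (j, d)) * V j d =
      φ (C (β (n + 1))⁻¹) * (φ (g ξ β (n + 1)) *
        (∑ j ∈ Finset.range (n + 1), ∑ d, φ (C (D j a d)) * V j d) +
      φ (h σ n) * ∑ d, φ (C (D (n + 1) a d)) * V n d) := by
    have h1 : ∀ j : Fin (n + 1), ∑ d : Fin m, φ (M (n + 1) σ ξ β D a (j, d)) * V j d =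
        φ (C (β (n + 1))⁻¹) * φ (g ξ β (n + 1)) * (∑ d, φ (C (D j a d)) * V j d) +
        if (j : ℕ) = n then
          φ (C (β (n + 1))⁻¹) * φ (h σ n) * ∑ d, φ (C (D (n + 1) a d)) * V n d else 0 := by
      intro j
      by_cases hj : (j : ℕ) = n
      · simp only [M, Matrix.of_apply, hj, if_true, Finset.mul_sum, ← Finset.sum_add_distrib,
          map_add, map_mul, Nat.add_sub_cancel]
        exact Finset.sum_congr rfl fun d _ => by ring
      · have hj' : ¬ (j : ℕ) + 1 = n + 1 := by omega
        simp only [M, Matrix.of_apply, hj, hj', if_false, Finset.mul_sum, add_zero, map_mul]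
        exact Finset.sum_congr rfl fun d _ => by ring
    rw [Finset.sum_congr rfl fun j _ => h1 j, Finset.sum_add_distrib, ← Finset.mul_sum,
      Fin.sum_univ_eq_sum_range (fun j => ∑ d, φ (C (D j a d)) * V j d),
      Fin.sum_univ_eq_sum_range (fun j => if j = n then
          φ (C (β (n + 1))⁻¹) * φ (h σ n) * ∑ d, φ (C (D (n + 1) a d)) * V n d else 0),
      Finset.sum_ite_eq', if_pos (by simp)]
    ring
  rw [← key, Fin.sum_univ_succ, sub_eq_add_neg]
  congr 1
  rw [← Pi.neg_apply, ← Matrix.neg_mulVec]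
  have : -(blockC (LPart hN σ ξ β D)).map φ =
      ((LPart hN σ ξ β D).toBlocks₁₂).map φ := by
    ext p q
    simp [blockC]
  rw [this]
  exact Fintype.sum_prod_type _

end Blocks

/-! ### The transfer function matrix -/

section Transfer

variable {F : Type*} [Field F] {m n : ℕ} {σ : ℕ → F} {ξ : ℕ → OnePoint F} {β : ℕ → F}
  {D : ℕ → Matrix (Fin m) (Fin m) F}

theorem b_succ_mul_g {i : ℕ} (hβ : β (i + 1) ≠ 0) :
    algebraMap F[X] (RatFunc F) (g ξ β (i + 1)) * b σ ξ β (i + 1) =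
      algebraMap F[X] (RatFunc F) (h σ i) * b σ ξ β i := by
  have hg : algebraMap F[X] (RatFunc F) (g ξ β (i + 1)) ≠ 0 := by
    rw [Ne, map_eq_zero_iff _ (RatFunc.algebraMap_injective F)]
    exact g_ne_zero hβ
  rw [b, b, Finset.prod_Icc_succ_top (by omega), Nat.add_sub_cancel]
  field_simp

theorem isSystemMatrix_LPart (hN : 1 ≤ n + 1) (hβ : ∀ i, i ≤ n + 1 → β i ≠ 0) :
    IsSystemMatrix (LPart hN σ ξ β D) := by
  rw [IsSystemMatrix, det_stateA]
  exact pow_ne_zero _ (Finset.prod_ne_zero_iff.2 fun i _ => g_ne_zero (hβ _ (by omega)))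

/-- The block column `b_0 I, …, b_n I` is annihilated by the lower block row of the pencil, and the
upper one sends it to `(1 - λ/ξ_N) Q_N`. Eliminating its lower blocks gives `b_0 = 1/β_0` times the
transfer function matrix. -/
theorem transfer_LPart (hN : 1 ≤ n + 1) (hβ : ∀ i, i ≤ n + 1 → β i ≠ 0) :
    transfer (LPart hN σ ξ β D) =
      (RatFunc.C (β 0) * algebraMap F[X] (RatFunc F) (poleFactor (ξ (n + 1)))) •
        Q (n + 1) σ ξ β D := by
  set P := LPart hN σ ξ β D
  let φ := algebraMap F[X] (RatFunc F)
  let V : Fin m → ℕ → Fin m → RatFunc F := fun e j c =>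
    b σ ξ β j * (1 : Matrix (Fin m) (Fin m) (RatFunc F)) c e
  let Y : Matrix (Fin (n + 1 - 1) × Fin m) (Fin m) (RatFunc F) :=
    Matrix.of fun p e => V e (p.1 + 1) p.2
  have hdet : IsUnit (toRat (stateA P)).det := by
    have h1 : (toRat (stateA P)).det = φ (stateA P).det := (RingHom.map_det φ _).symm
    rw [h1, isUnit_iff_ne_zero, Ne, map_eq_zero_iff _ (RatFunc.algebraMap_injective F)]
    exact isSystemMatrix_LPart hN hβ
  have hV0 : (Matrix.of fun c e => V e 0 c) =
      b σ ξ β 0 • (1 : Matrix (Fin m) (Fin m) (RatFunc F)) := by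
    ext c e
    simp [V]
  have hlow : toRat (blockB P) * (Matrix.of fun c e => V e 0 c) + toRat (stateA P) * Y = 0 := by
    ext ⟨i, c⟩ e
    have := lower_mulVec σ ξ β D φ hN (V e) i c
    refine Eq.trans this ?_
    simp only [V, ← mul_assoc]
    rw [b_succ_mul_g (hβ _ (by omega)), sub_self]
    rfl
  have hup : toRat (blockD P) * (Matrix.of fun c e => V e 0 c) - toRat (blockC P) * Y =
      φ (poleFactor (ξ (n + 1))) • Q (n + 1) σ ξ β D := by
    ext a e
    have := upper_mulVec σ ξ β D φ hN (V e) a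
    refine Eq.trans this ?_
    have h1 : ∀ i j, ∑ d, φ (C (D i a d)) * V e j d = b σ ξ β j * RatFunc.C (D i a e) := by
      intro i j
      rw [Finset.sum_eq_single e]
      · simp [V, φ, mul_comm]
      · intro d _ hd
        simp [V, Matrix.one_apply_ne hd]
      · simp
    have h2 : φ (h σ n) * (b σ ξ β n * RatFunc.C (D (n + 1) a e)) =
        φ (g ξ β (n + 1)) * (b σ ξ β (n + 1) * RatFunc.C (D (n + 1) a e)) := by
      rw [← mul_assoc, ← mul_assoc, b_succ_mul_g (hβ _ le_rfl)]
    have h3 : φ (C (β (n + 1))⁻¹) * φ (g ξ β (n + 1)) = φ (poleFactor (ξ (n + 1))) := by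
      rw [← map_mul, g, ← mul_assoc, ← C_mul, inv_mul_cancel₀ (hβ _ le_rfl), C_1, one_mul]
    simp only [h1]
    rw [h2, ← mul_add, ← Finset.sum_range_succ (fun j => b σ ξ β j * RatFunc.C (D j a e)),
      ← mul_assoc, h3]
    simp [Q, Matrix.sum_apply, constRat]
  have hb : RatFunc.C (β 0) * b σ ξ β 0 = 1 := by
    have : (RatFunc.C (β 0) : RatFunc F) ≠ 0 := by simpa using hβ 0 (by omega)
    simp [b, this]
  have hY : b σ ξ β 0 • ((toRat (stateA P))⁻¹ * toRat (blockB P)) = -Y := by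
    rw [hV0, Matrix.mul_smul, Matrix.mul_one] at hlow
    rw [← Matrix.mul_smul, eq_neg_of_add_eq_zero_left hlow, Matrix.mul_neg,
      Matrix.nonsing_inv_mul_cancel_left _ _ hdet]
  have ht : b σ ξ β 0 • transfer P = φ (poleFactor (ξ (n + 1))) • Q (n + 1) σ ξ β D := by
    rw [← hup, hV0, transfer, smul_add, Matrix.mul_assoc, ← Matrix.mul_smul _ (b σ ξ β 0) (_ * _),
      hY, Matrix.mul_smul, Matrix.mul_one, Matrix.mul_neg, sub_eq_add_neg]
  rw [mul_smul, ← ht, smul_smul, hb, one_smul]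

end Transfer

/-! ### Minimality -/

section Minimality

variable {F : Type*} [Field F] {m n : ℕ} {σ : ℕ → F} {ξ : ℕ → OnePoint F} {β : ℕ → F}
  {D : ℕ → Matrix (Fin m) (Fin m) F} {x : F}

theorem det_evalPoly {ι : Type*} [Fintype ι] [DecidableEq ι] (A : Matrix ι ι F[X]) (x : F) :
    (evalPoly A x).det = A.det.eval x :=
  (RingHom.map_det (evalRingHom x) A).symm

/-- If no factor `h_j` vanishes at `x`, the first `N - 1` block columns of `K_N(x)` are
independent; if no factor `g_i` does, the last `N - 1` block columns are. -/
theorem rank_fromCols_stateA_blockB (hN : 1 ≤ n + 1)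
    (hx : (∀ i, 1 ≤ i → i ≤ n → (g ξ β i).eval x ≠ 0) ∨ ∀ j, j < n → (h σ j).eval x ≠ 0) :
    (Matrix.fromCols (evalPoly (stateA (LPart hN σ ξ β D)) x)
      (evalPoly (blockB (LPart hN σ ξ β D)) x)).rank = Fintype.card (Fin n × Fin m) := by
  rcases hx with hx | hx
  · refine rank_eq_card_of_submatrix_det_ne_zero _ Sum.inl ?_
    change (evalPoly (stateA (LPart hN σ ξ β D)) x).det ≠ 0
    rw [det_evalPoly, det_stateA, eval_pow, eval_prod]
    exact pow_ne_zero _ (Finset.prod_ne_zero_iff.2 fun i _ => hx _ (by omega) (by omega))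
  -- Block column `0` of `K_N` is that of `B_N`, and block column `j > 0` is column `j - 1` of `A_N`.
  · let c : Fin n × Fin m → (Fin n × Fin m) ⊕ Fin m := fun p =>
      if (p.1 : ℕ) = 0 then Sum.inr p.2 else Sum.inl (⟨p.1 - 1, by omega⟩, p.2)
    refine rank_eq_card_of_submatrix_det_ne_zero _ c ?_
    have hsub : (Matrix.fromCols (evalPoly (stateA (LPart hN σ ξ β D)) x)
        (evalPoly (blockB (LPart hN σ ξ β D)) x)).submatrix id c =
        evalPoly (Matrix.kronecker ((bidiag (n + 1) σ ξ β).submatrix id Fin.castSucc)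
          (1 : Matrix (Fin m) (Fin m) F[X])) x := by
      ext ⟨i, a⟩ ⟨j, d⟩
      by_cases hj : (j : ℕ) = 0
      · have : Fin.castSucc j = (⟨0, hN⟩ : Fin (n + 1)) := Fin.ext hj
        simp only [Matrix.submatrix_apply, c, hj, if_true, Matrix.fromCols_apply_inr, id]
        simp only [evalPoly, Matrix.map_apply, Matrix.kronecker, Matrix.kroneckerMap_apply,
          Matrix.submatrix_apply, this, id]
        rfl
      · have : Fin.castSucc j = (⟨(j : ℕ) - 1 + 1, by omega⟩ : Fin (n + 1)) :=
          Fin.ext (by simp; omega)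
        simp only [Matrix.submatrix_apply, c, hj, if_false, Matrix.fromCols_apply_inl, id]
        simp only [evalPoly, Matrix.map_apply, Matrix.kronecker, Matrix.kroneckerMap_apply,
          Matrix.submatrix_apply, this, id]
        rfl
    rw [hsub, det_evalPoly]
    erw [Matrix.det_kronecker, det_bidiag_castSucc]
    rw [Matrix.det_one, one_pow, mul_one, eval_pow, eval_prod, Fintype.card_fin]
    exact pow_ne_zero _ (Finset.prod_ne_zero_iff.2 fun i _ => by
      rw [eval_neg]; exact neg_ne_zero.2 (hx _ i.2))

/-- The value of `R_N` at a point that is not a node. -/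
noncomputable def valueR (N : ℕ) (σ : ℕ → F) (ξ : ℕ → OnePoint F) (β : ℕ → F)
    (D : ℕ → Matrix (Fin m) (Fin m) F) (x : F) : Matrix (Fin m) (Fin m) F :=
  (∑ j ∈ Finset.Icc 1 (N - 1),
    (∏ k ∈ Finset.Icc (j + 1) N, (g ξ β k).eval x / (h σ (k - 1)).eval x) • D j) + D N

theorem hasValueAt_R {N : ℕ} (hN : 1 ≤ N) (hh : ∀ j, j < N → (h σ j).eval x ≠ 0) (a c : Fin m) :
    HasValueAt (R N σ ξ β D a c) x (valueR N σ ξ β D x a c) := by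
  simp only [R, valueR, Matrix.add_apply, Matrix.sum_apply, Matrix.smul_apply, smul_eq_mul,
    constRat, Matrix.map_apply]
  refine (HasValueAt.sum _ fun j _ => ?_).add (hasValueAt_C _ _)
  refine (HasValueAt.prod _ fun k hk => hasValueAt_div _ (hh _ ?_)).mul (hasValueAt_C _ _)
  have := (Finset.mem_Icc.1 hk).2
  omega

theorem evalRat_R {N : ℕ} (hN : 1 ≤ N) (hh : ∀ j, j < N → (h σ j).eval x ≠ 0) :
    evalRat (R N σ ξ β D) x = valueR N σ ξ β D x := by
  ext a c
  exact (hasValueAt_R hN hh a c).2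

/-- The entries of the block vectors annihilated by the lower block row of the pencil at `x`,
relative to the last one. -/
noncomputable def kernelCoeff (n : ℕ) (σ : ℕ → F) (ξ : ℕ → OnePoint F) (β : ℕ → F) (x : F)
    (j : ℕ) : F :=
  ∏ k ∈ Finset.Icc (j + 1) n, (g ξ β k).eval x / (h σ (k - 1)).eval x

theorem kernelCoeff_self : kernelCoeff n σ ξ β x n = 1 := by simp [kernelCoeff]

theorem kernelCoeff_eq_mul {j : ℕ} (hj : j < n) :
    kernelCoeff n σ ξ β x j =
      (g ξ β (j + 1)).eval x / (h σ j).eval x * kernelCoeff n σ ξ β x (j + 1) := by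
  rw [kernelCoeff, kernelCoeff, ← Finset.mul_prod_Ioc_eq_prod_Icc (by omega : j + 1 ≤ n),
    Finset.Icc_add_one_left_eq_Ioc, Nat.add_sub_cancel]

theorem kernelCoeff_zero {k : ℕ} (h1 : 1 ≤ k) (hkn : k ≤ n) (hk : (g ξ β k).eval x = 0) :
    kernelCoeff n σ ξ β x 0 = 0 :=
  Finset.prod_eq_zero (Finset.mem_Icc.2 ⟨by omega, hkn⟩) (by rw [hk, zero_div])

/-- The upper block row of the pencil, applied to a block vector in the kernel of the lower one,
is `R_N(x)` applied to its last block, up to a nonzero factor. -/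
theorem upper_kernelCoeff {k : ℕ} (h1 : 1 ≤ k) (hkn : k ≤ n) (hk : (g ξ β k).eval x = 0)
    (hh : (h σ n).eval x ≠ 0) (u : Fin m → F) (a : Fin m) :
    (g ξ β (n + 1)).eval x * (∑ j ∈ Finset.range (n + 1),
        ∑ d, D j a d * (kernelCoeff n σ ξ β x j * u d)) +
      (h σ n).eval x * ∑ d, D (n + 1) a d * u d =
    (h σ n).eval x * (valueR (n + 1) σ ξ β D x).mulVec u a := by
  have hsum : ∀ j, ∑ d, D j a d * (kernelCoeff n σ ξ β x j * u d) =
      kernelCoeff n σ ξ β x j * (D j).mulVec u a := by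
    intro j
    rw [Matrix.mulVec, dotProduct, Finset.mul_sum]
    exact Finset.sum_congr rfl fun d _ => by ring
  have hprod : ∀ j ∈ Finset.Icc 1 n, ∏ k ∈ Finset.Icc (j + 1) (n + 1),
      (g ξ β k).eval x / (h σ (k - 1)).eval x =
      kernelCoeff n σ ξ β x j * ((g ξ β (n + 1)).eval x / (h σ n).eval x) := by
    intro j hj
    rw [Finset.prod_Icc_succ_top (by have := (Finset.mem_Icc.1 hj).2; omega)]
    rfl
  have hR : (valueR (n + 1) σ ξ β D x).mulVec u a =
      (∑ j ∈ Finset.Icc 1 n, kernelCoeff n σ ξ β x j *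
        ((g ξ β (n + 1)).eval x / (h σ n).eval x) * (D j).mulVec u a) +
      (D (n + 1)).mulVec u a := by
    rw [valueR, Nat.add_sub_cancel, Finset.sum_congr rfl fun j hj => by rw [hprod j hj],
      Matrix.add_mulVec, Matrix.sum_mulVec, Pi.add_apply, Finset.sum_apply]
    simp only [Matrix.smul_mulVec, Pi.smul_apply, smul_eq_mul]
  have hrange : ∑ j ∈ Finset.range (n + 1), kernelCoeff n σ ξ β x j * (D j).mulVec u a =
      ∑ j ∈ Finset.Icc 1 n, kernelCoeff n σ ξ β x j * (D j).mulVec u a := by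
    rw [Finset.sum_range_succ', kernelCoeff_zero h1 hkn hk, zero_mul, add_zero,
      Finset.range_eq_Ico,
      Finset.sum_Ico_add' (fun j => kernelCoeff n σ ξ β x j * (D j).mulVec u a) 0 n 1, zero_add,
      Finset.Ico_add_one_right_eq_Icc]
  rw [Finset.sum_congr rfl fun j _ => hsum j, hrange, hR, mul_add]
  simp only [Finset.mul_sum]
  congr 1
  · exact Finset.sum_congr rfl fun j _ => by field_simp
  · rw [← Finset.mul_sum]
    rfl

/-- With the convention `V 0 = 0`, a block vector lies in the common kernel of `A_N(x)` and `C_N(x)`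
if and only if it satisfies the two-term recurrence of `K_N(x)` and the equation of `M_N(x)`. -/
theorem fromRows_mulVec_eq_zero_iff (hN : 1 ≤ n + 1) (hβ : β (n + 1) ≠ 0)
    (V : ℕ → Fin m → F) (hV : V 0 = 0) :
    (Matrix.fromRows (evalPoly (stateA (LPart hN σ ξ β D)) x)
      (evalPoly (blockC (LPart hN σ ξ β D)) x)).mulVec (fun p => V (p.1 + 1) p.2) = 0 ↔
    (∀ i, i < n → ∀ c, (g ξ β (i + 1)).eval x * V (i + 1) c = (h σ i).eval x * V i c) ∧
    ∀ a, (g ξ β (n + 1)).eval x * (∑ j ∈ Finset.range (n + 1), ∑ d, D j a d * V j d) +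
      (h σ n).eval x * ∑ d, D (n + 1) a d * V n d = 0 := by
  have hlow := lower_mulVec σ ξ β D (evalRingHom x) hN V
  have hup := upper_mulVec σ ξ β D (evalRingHom x) hN V
  simp only [hV, Matrix.mulVec_zero, Pi.zero_apply, zero_add, zero_sub, coe_evalRingHom,
    eval_C] at hlow hup
  rw [Matrix.fromRows_mulVec, ← Sum.elim_zero_zero, Sum.elim_eq_iff]
  refine and_congr ?_ ?_
  · constructor
    · intro hA i hi c
      have := hlow ⟨i, hi⟩ c
      rw [← sub_eq_zero, ← this]
      exact congrFun hA (⟨i, hi⟩, c)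
    · intro hA
      ext ⟨i, c⟩
      exact (hlow i c).trans (sub_eq_zero.2 (hA i i.2 c))
  · constructor
    · intro hC a
      have h1 : _ = (0 : F) := congrFun hC a
      have := hup a
      erw [h1, neg_zero] at this
      exact (mul_eq_zero.1 this.symm).resolve_left (inv_ne_zero hβ)
    · intro hC
      ext a
      have := hup a
      rw [hC a, mul_zero] at this
      exact neg_eq_zero.1 this

/-- At a pole among `ξ_1, …, ξ_{N-1}`, the common kernel of `A_N` and `C_N` is isomorphic to the
kernel of `R_N`, by taking the last block. -/
theorem rank_fromRows_iff_of_pole (hN : 1 ≤ n + 1) (hβ : β (n + 1) ≠ 0) {k : ℕ} (h1 : 1 ≤ k)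
    (hkn : k ≤ n) (hk : (g ξ β k).eval x = 0) (hh : ∀ j, j < n + 1 → (h σ j).eval x ≠ 0) :
    (Matrix.fromRows (evalPoly (stateA (LPart hN σ ξ β D)) x)
      (evalPoly (blockC (LPart hN σ ξ β D)) x)).rank = Fintype.card (Fin n × Fin m) ↔
    (evalRat (R (n + 1) σ ξ β D) x).det ≠ 0 := by
  rw [evalRat_R hN hh]
  refine (rank_eq_card_width_iff (κ := Fin n × Fin m) _).trans ?_
  constructor
  · intro hker hdet
    obtain ⟨u, hu, hRu⟩ := Matrix.exists_mulVec_eq_zero_iff.2 hdet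
    refine hu ?_
    have hz := hker _ ((fromRows_mulVec_eq_zero_iff hN hβ
      (fun j c => kernelCoeff n σ ξ β x j * u c) ?_).2 ⟨?_, ?_⟩)
    · ext c
      have := congrFun hz (⟨n - 1, by omega⟩, c)
      simpa [Nat.sub_add_cancel (h1.trans hkn), kernelCoeff_self] using this
    · ext c
      simp [kernelCoeff_zero h1 hkn hk]
    · intro i hi c
      have := hh i (by omega)
      rw [kernelCoeff_eq_mul hi]
      field_simp
    · intro a
      have := upper_kernelCoeff (D := D) h1 hkn hk (hh n (by omega)) u a
      rw [hRu] at this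
      simpa [kernelCoeff_self] using this
  · intro hdet v hv
    -- The block vector `0, v`, extended by zero.
    let V : ℕ → Fin m → F := fun j c =>
      if hj : 0 < j ∧ j - 1 < n then v (⟨j - 1, hj.2⟩, c) else 0
    have hvV : v = fun p => V (p.1 + 1) p.2 := by
      ext ⟨i, c⟩
      simp [V]
    have hV0 : V 0 = 0 := by
      ext c
      simp [V]
    rw [hvV] at hv
    obtain ⟨hlow, hup⟩ := (fromRows_mulVec_eq_zero_iff hN hβ V hV0).1 hv
    have hVj : ∀ j, j ≤ n → ∀ c, V j c = kernelCoeff n σ ξ β x j * V n c := by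
      intro j hj
      induction hj using Nat.decreasingInduction with
      | self => simp [kernelCoeff_self]
      | of_succ j hj ih =>
        intro c
        have h2 := hlow j hj c
        have h3 := hh j (by omega)
        rw [kernelCoeff_eq_mul hj, mul_assoc, ← ih c]
        field_simp
        rw [h2, mul_comm]
    have hRV : (valueR (n + 1) σ ξ β D x).mulVec (V n) = 0 := by
      ext a
      have h2 := upper_kernelCoeff (D := D) h1 hkn hk (hh n (by omega)) (V n) a
      have h3 := hup a
      rw [Finset.sum_congr rfl fun j hj => Finset.sum_congr rfl fun d _ => by
        rw [hVj j (Nat.lt_succ_iff.1 (Finset.mem_range.1 hj)) d], h2] at h3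
      exact (mul_eq_zero.1 h3).resolve_left (hh n (by omega))
    have hVn : V n = 0 := by
      by_contra hne
      exact hdet (Matrix.exists_mulVec_eq_zero_iff.1 ⟨V n, hne, hRV⟩)
    rw [hvV]
    ext ⟨i, c⟩
    change V (i + 1) c = 0
    rw [hVj _ i.2, hVn]
    simp

theorem isMinimalAt_LPart_iff (hN : 1 ≤ n + 1)
    (hξ : ∀ i, 1 ≤ i → i ≤ n + 1 → ξ i ≠ ((0 : F) : OnePoint F))
    (hβ : ∀ i, i ≤ n + 1 → β i ≠ 0)
    (hξσ : ∀ i j, 1 ≤ i → i ≤ n + 1 → j < n + 1 → ξ i ≠ (σ j : OnePoint F)) (x : F) :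
    IsMinimalAt (LPart hN σ ξ β D) x ↔
      ∀ k, 1 ≤ k → k ≤ n → ξ k = (x : OnePoint F) →
        (evalRat (R (n + 1) σ ξ β D) x).det ≠ 0 := by
  by_cases hx : ∃ k, 1 ≤ k ∧ k ≤ n ∧ ξ k = (x : OnePoint F)
  · obtain ⟨k, h1, hkn, hk⟩ := hx
    have hgk := (eval_g_eq_zero_iff (hξ k h1 (by omega)) (hβ k (by omega)) x).2 hk
    have hh : ∀ j, j < n + 1 → (h σ j).eval x ≠ 0 := by
      intro j hj h0
      refine hξσ k j h1 (by omega) hj ?_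
      rw [hk, OnePoint.coe_eq_coe]
      simpa [h, sub_eq_zero] using h0
    have hiff := rank_fromRows_iff_of_pole (D := D) hN (hβ _ le_rfl) h1 hkn hgk hh
    constructor
    · exact fun hmin _ _ _ _ => hiff.1 hmin.1
    · exact fun hdet => ⟨hiff.2 (hdet k h1 hkn hk),
        rank_fromCols_stateA_blockB hN (Or.inr fun j hj => hh j (by omega))⟩
  · push Not at hx
    have hg : ∀ i, 1 ≤ i → i ≤ n → (g ξ β i).eval x ≠ 0 := fun i h1 hi h0 =>
      hx i h1 hi ((eval_g_eq_zero_iff (hξ i h1 (by omega)) (hβ i (by omega)) x).1 h0)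
    refine iff_of_true ⟨?_, rank_fromCols_stateA_blockB hN (Or.inl hg)⟩
      fun k h1 hk hkx => absurd hkx (hx k h1 hk)
    refine (rank_eq_card_width_iff (κ := Fin n × Fin m) _).2 fun v hv => ?_
    rw [Matrix.fromRows_mulVec, ← Sum.elim_zero_zero, Sum.elim_eq_iff] at hv
    by_contra hne
    refine absurd (Matrix.exists_mulVec_eq_zero_iff.1 ⟨v, hne, hv.1⟩) ?_
    rw [det_evalPoly]
    erw [det_stateA]
    rw [eval_pow, eval_prod]
    exact pow_ne_zero _ (Finset.prod_ne_zero_iff.2 fun i _ => hg _ (by omega) (by omega))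

end Minimality

/-! ### Linearization -/

section Linearization

variable {F : Type*} [Field F] {m n : ℕ} {σ : ℕ → F} {ξ : ℕ → OnePoint F} {β : ℕ → F}
  {D : ℕ → Matrix (Fin m) (Fin m) F} {x : F}

theorem natDegree_g_le (i : ℕ) : (g ξ β i).natDegree ≤ 1 := by
  unfold g poleFactor
  compute_degree

theorem natDegree_h_le (j : ℕ) : (h σ j).natDegree ≤ 1 := by
  unfold h
  compute_degree

theorem natDegree_LPart_le {N : ℕ} (hN : 1 ≤ N) (p q : Fin m ⊕ (Fin (N - 1) × Fin m)) :
    (LPart hN σ ξ β D p q).natDegree ≤ 1 := by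
  rw [LPart, Matrix.submatrix_apply]
  generalize colSplit hN m q = q
  obtain ⟨j, d⟩ := q
  have hmul : ∀ (a c : F) (p : F[X]), p.natDegree ≤ 1 → (C a * p * C c).natDegree ≤ 1 :=
    fun a c p hp => (natDegree_mul_C_le _ _).trans ((natDegree_C_mul_le _ _).trans hp)
  rcases p with a | ⟨i, c⟩
  · simp only [L, id, Matrix.fromRows_apply_inl, M, Matrix.of_apply]
    refine natDegree_add_le_of_degree_le (hmul _ _ _ (natDegree_g_le _)) ?_
    split_ifs
    · exact hmul _ _ _ (natDegree_h_le _)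
    · simp
  · simp only [L, id, Matrix.fromRows_apply_inr, K, Matrix.kroneckerMap_apply, bidiag,
      Matrix.of_apply, Matrix.one_apply, mul_ite, mul_one, mul_zero]
    split_ifs
    · rw [natDegree_neg]
      exact natDegree_h_le _
    · exact natDegree_g_le _
    all_goals simp

theorem isRegularAt_smul_one {ι : Type*} [Fintype ι] [DecidableEq ι] {f : RatFunc F} {v : F}
    (hf : HasValueAt f x v) (hv0 : v ≠ 0) :
    IsRegularAt (f • (1 : Matrix ι ι (RatFunc F))) x := by
  have hv : ∀ i j, HasValueAt ((f • (1 : Matrix ι ι (RatFunc F))) i j) x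
      ((v • (1 : Matrix ι ι F)) i j) := by
    intro i j
    by_cases hij : i = j
    · subst hij
      simpa using hf
    · simpa [Matrix.one_apply_ne hij] using hasValueAt_C 0 x
  refine ⟨fun i j => (hv i j).1, ?_⟩
  have : evalRat (f • (1 : Matrix ι ι (RatFunc F))) x = v • 1 := by
    ext i j
    exact (hv i j).2
  rw [this, Matrix.det_smul, Matrix.det_one, mul_one]
  exact pow_ne_zero _ hv0

theorem isRegularAt_one {ι : Type*} [Fintype ι] [DecidableEq ι] (x : F) :
    IsRegularAt (1 : Matrix ι ι (RatFunc F)) x := by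
  simpa using isRegularAt_smul_one (ι := ι) (hasValueAt_C 1 x) one_ne_zero

/-- Away from `ξ_N` the scalar `β_0 (1 - λ/ξ_N)` is a nonzero value, so that the transfer function
matrix and `Q_N` differ by a regular factor. -/
theorem isLinearizationAt_LPart (hN : 1 ≤ n + 1)
    (hξ : ξ (n + 1) ≠ ((0 : F) : OnePoint F)) (hβ : ∀ i, i ≤ n + 1 → β i ≠ 0)
    (hmin : IsMinimalAt (LPart hN σ ξ β D) x) (hx : ξ (n + 1) ≠ (x : OnePoint F)) :
    IsLinearizationAt (LPart hN σ ξ β D) (Q (n + 1) σ ξ β D) x := by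
  have hpole : (poleFactor (ξ (n + 1))).eval x ≠ 0 := by
    intro h0
    refine hx ((eval_g_eq_zero_iff hξ (hβ _ le_rfl) x).1 ?_)
    rw [g, eval_mul, h0, mul_zero]
  refine ⟨isSystemMatrix_LPart hN hβ, natDegree_LPart_le hN, hmin, 0, 0, Equiv.refl _,
    Equiv.refl _, (RatFunc.C (β 0) * algebraMap F[X] (RatFunc F) (poleFactor (ξ (n + 1)))) • 1, 1,
    isRegularAt_smul_one ((hasValueAt_C _ _).mul (hasValueAt_algebraMap _ _))
      (mul_ne_zero (hβ 0 (by omega)) hpole), isRegularAt_one x, ?_⟩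
  rw [Matrix.mul_one, Matrix.smul_mul, Matrix.one_mul, transfer_LPart hN hβ]
  ext (i | i) (j | j)
  · simp [diagId]
  · exact j.elim0
  · exact i.elim0
  · exact i.elim0

end Linearization

end NLEIGS

theorem theorem6p5 {F : Type*} [Field F] [IsAlgClosed F] {N m : ℕ} (hN : 1 ≤ N)
    (σ : ℕ → F) (ξ : ℕ → OnePoint F) (β : ℕ → F) (D : ℕ → Matrix (Fin m) (Fin m) F)
    (hξ : ∀ i, 1 ≤ i → i ≤ N → ξ i ≠ ((0 : F) : OnePoint F))
    (hβ : ∀ i, i ≤ N → β i ≠ 0) :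
    -- `L_N` is a polynomial system matrix with the stated transfer function matrix
    (NLEIGS.IsSystemMatrix (NLEIGS.LPart hN σ ξ β D) ∧
      NLEIGS.transfer (NLEIGS.LPart hN σ ξ β D) =
        (RatFunc.C (β 0) * algebraMap (Polynomial F) (RatFunc F) (NLEIGS.poleFactor (ξ N))) •
          NLEIGS.Q N σ ξ β D) ∧
    ((∀ i j, 1 ≤ i → i ≤ N → j < N → ξ i ≠ (σ j : OnePoint F)) →
      -- `R_N` has a value at the finite poles among `ξ_1, …, ξ_{N-1}`
      (∀ k, 1 ≤ k → k ≤ N - 1 → ∀ x : F, ξ k = (x : OnePoint F) →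
        NLEIGS.IsDefinedAt (NLEIGS.R N σ ξ β D) x) ∧
      -- the criterion for minimality
      (NLEIGS.IsMinimalOn (NLEIGS.LPart hN σ ξ β D) Set.univ ↔
        ∀ k, 1 ≤ k → k ≤ N - 1 → ∀ x : F, ξ k = (x : OnePoint F) →
          (NLEIGS.evalRat (NLEIGS.R N σ ξ β D) x).det ≠ 0) ∧
      -- the linearization theorem
      ((∀ k, 1 ≤ k → k ≤ N - 1 → ∀ x : F, ξ k = (x : OnePoint F) →
          (NLEIGS.evalRat (NLEIGS.R N σ ξ β D) x).det ≠ 0) →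
        NLEIGS.IsMinimalOn (NLEIGS.LPart hN σ ξ β D) Set.univ ∧
        (ξ N = OnePoint.infty →
          NLEIGS.IsLinearizationOn (NLEIGS.LPart hN σ ξ β D) (NLEIGS.Q N σ ξ β D) Set.univ) ∧
        (∀ x : F, ξ N = (x : OnePoint F) →
          NLEIGS.IsLinearizationOn (NLEIGS.LPart hN σ ξ β D) (NLEIGS.Q N σ ξ β D) {x}ᶜ))) := by
  obtain ⟨n, rfl⟩ : ∃ n, N = n + 1 := ⟨N - 1, by omega⟩
  refine ⟨⟨NLEIGS.isSystemMatrix_LPart hN hβ, NLEIGS.transfer_LPart hN hβ⟩, fun hξσ => ?_⟩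
  have hmin := NLEIGS.isMinimalAt_LPart_iff (D := D) hN hξ hβ hξσ
  have hmin' : NLEIGS.IsMinimalOn (NLEIGS.LPart hN σ ξ β D) Set.univ ↔
      ∀ k, 1 ≤ k → k ≤ n → ∀ x : F, ξ k = (x : OnePoint F) →
        (NLEIGS.evalRat (NLEIGS.R (n + 1) σ ξ β D) x).det ≠ 0 :=
    ⟨fun hm k h1 hk x hx => (hmin x).1 (hm x trivial) k h1 hk hx,
      fun hd x _ => (hmin x).2 fun k h1 hk hx => hd k h1 hk x hx⟩
  have hlast := hξ (n + 1) hN le_rfl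
  refine ⟨fun k h1 hk x hx a c => (NLEIGS.hasValueAt_R hN ?_ a c).1, hmin',
    fun hd => ⟨hmin'.2 hd, fun hinf x _ => ?_, fun y hy x hx => ?_⟩⟩
  · intro j hj h0
    refine hξσ k j h1 (by omega) hj ?_
    rw [hx, OnePoint.coe_eq_coe]
    simpa [NLEIGS.h, sub_eq_zero] using h0
  · refine NLEIGS.isLinearizationAt_LPart hN hlast hβ (hmin'.2 hd x trivial) ?_
    rw [hinf]
    exact OnePoint.infty_ne_coe x
  · refine NLEIGS.isLinearizationAt_LPart hN hlast hβ (hmin'.2 hd x trivial) ?_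
    rw [hy, Ne, OnePoint.coe_eq_coe]
    exact fun hyx => hx hyx.symm
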